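/- Let $n \ge 1$ and $m \ge 2$ be integers and let $A = (a_{i_1 \cdots i_m})_{1 \le i_1,\ldots,i_m \le n}$ be an array of real numbers (a real tensor of order $m$ and rank $n$). Write $\oplus = \min$ and $\odot = +$ for the tropical operations. A tropical H-eigenpair of $A$ is a pair $(x,\lambda) \in \mathbb{R}^n/\mathbb{R}(1,\ldots,1) \times \mathbb{R}$ such that $$\bigoplus_{i_2,\ldots,i_m=1}^n a_{i i_2 \cdots i_m} \odot x_{i_2} \odot \cdots \odot x_{i_m} = \lambda \odot x_i^{\odot (m-1)}, \qquad i = 1,\ldots,n,$$ that is, $\min_{i_2,\ldots,i_m} \{ a_{i i_2 \cdots i_m} + x_{i_2} + \cdots + x_{i_m} \} = \lambda + (m-1) x_i$ for every $i$ (a condition that does not depend on the representative of $x$). A number $\lambda \in \mathbb{R}$ is called a tropical H-eigenvalue of $A$ if $(x,\lambda)$ is a tropical H-eigenpair of $A$ for some $x$. Then $A$ has exactly one tropical H-eigenvalue $\lambda(A) \in \mathbb{R}$. -/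

import Mathlib

/-- A real tensor of order `m` and rank `n`: an array `(a_{i_1 ⋯ i_m})` of real numbers indexed by
`[n]^m`. -/
abbrev RealTensor (m n : ℕ) : Type := (Fin m → Fin n) → ℝ

/-- The tropical projective torus `ℝ^n / ℝ(1, 1, …, 1)`. -/
abbrev TropicalTorus (n : ℕ) : Type :=
  (Fin n → ℝ) ⧸ Submodule.span ℝ {(1 : Fin n → ℝ)}

/-- A real number as an element of the min-plus semiring `(ℝ ∪ {∞}, ⊕, ⊙)`, where `⊕` (written `+`)
is the minimum and `⊙` (written `*`) is the ordinary addition. -/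
def toTrop (r : ℝ) : Tropical (WithTop ℝ) := Tropical.trop (r : WithTop ℝ)

/-- The tropical eigenvalue equations for a tensor of order `m = d + 1`:
`⨁_{i_2,…,i_m} a_{i i_2 ⋯ i_m} ⊙ x_{i_2} ⊙ ⋯ ⊙ x_{i_m} = l ⊙ x_i^{m-1}` for all `i`;
the tuple `(i_2, …, i_m)` is `J : Fin d → Fin n`. -/
def TropicalHEquations {d n : ℕ} (A : RealTensor (d + 1) n) (x : Fin n → ℝ) (l : ℝ) : Prop :=
  ∀ i : Fin n,
    ∑ J : Fin d → Fin n, toTrop (A (Fin.cons i J)) * ∏ k : Fin d, toTrop (x (J k)) =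
      toTrop l * toTrop (x i) ^ d

/-- The equations do not change when a multiple of `(1, …, 1)` is added to `x`. -/
theorem tropicalHEquations_congr {d n : ℕ} (A : RealTensor (d + 1) n) (l : ℝ)
    {x y : Fin n → ℝ} (h : y - x ∈ Submodule.span ℝ {(1 : Fin n → ℝ)})
    (hx : TropicalHEquations A x l) : TropicalHEquations A y l := by
  obtain ⟨c, hc⟩ := Submodule.mem_span_singleton.mp h
  have key : ∀ i, toTrop (y i) = toTrop c * toTrop (x i) := by
    intro i
    have hi : c = y i - x i := by simpa using congrFun hc i
    have hi' : y i = c + x i := by linarith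
    rw [hi']
    rfl
  intro i
  simp only [key, Finset.prod_mul_distrib, Finset.prod_const, Finset.card_univ, Fintype.card_fin,
    mul_pow]
  calc ∑ J : Fin d → Fin n,
        toTrop (A (Fin.cons i J)) * (toTrop c ^ d * ∏ k : Fin d, toTrop (x (J k)))
      = toTrop c ^ d *
        ∑ J : Fin d → Fin n, toTrop (A (Fin.cons i J)) * ∏ k : Fin d, toTrop (x (J k)) := by
        rw [Finset.mul_sum]
        exact Finset.sum_congr rfl fun J _ => mul_left_comm _ _ _
    _ = toTrop l * (toTrop c ^ d * toTrop (x i) ^ d) := by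
        rw [hx i, mul_left_comm]

/-- A tropical H-eigenpair `(x, l) ∈ ℝ^n / ℝ(1, …, 1) × ℝ` of a tensor of order `d + 1`:
the equations hold for a representative of `x` (equivalently, for every representative). -/
def IsTropicalHEigenpair {d n : ℕ} (A : RealTensor (d + 1) n) (x : TropicalTorus n) (l : ℝ) :
    Prop :=
  ∃ v : Fin n → ℝ, Submodule.Quotient.mk v = x ∧ TropicalHEquations A v l

/-- The notion of eigenpair is independent of the representative. -/
theorem isTropicalHEigenpair_mk {d n : ℕ} (A : RealTensor (d + 1) n) (v : Fin n → ℝ) (l : ℝ) :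
    IsTropicalHEigenpair A (Submodule.Quotient.mk v) l ↔ TropicalHEquations A v l := by
  constructor
  · rintro ⟨w, hw, h⟩
    exact tropicalHEquations_congr A l ((Submodule.Quotient.eq _).mp hw.symm) h
  · exact fun h => ⟨v, rfl, h⟩

/-- `l` is a tropical H-eigenvalue of `A` if it belongs to some tropical H-eigenpair. -/
def IsTropicalHEigenvalue {d n : ℕ} (A : RealTensor (d + 1) n) (l : ℝ) : Prop :=
  ∃ x : TropicalTorus n, IsTropicalHEigenpair A x l

/-! With `d = m - 1`, dividing the tropical forms by `d` turns the equations into `T x = l / d + x`,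
where `T` is monotone and commutes with adding constants. Existence is a vanishing-discount argument
(`exists_additive_eigenvector`): `T` is nonexpansive, so `x ↦ T (u • x)` has a fixed point for `0 <
u < 1`. Since all entries of `A` are finite, `T` has bounded oscillation, so the normalized fixed
points subconverge as `u → 1`, to an eigenvector. Uniqueness is a comparison of two eigenvectors
(`additive_eigenvalue_le`). -/

/-- A monotone, additively homogeneous self-map of `ℝ^ι` is nonexpansive for the sup norm. -/
theorem lipschitzWith_one_of_monotone_of_add_const {ι : Type*} [Fintype ι]
    {T : (ι → ℝ) → ι → ℝ} (hmono : Monotone T)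
    (hadd : ∀ (x : ι → ℝ) (c : ℝ) (i : ι), T (fun j => x j + c) i = T x i + c) :
    LipschitzWith 1 T := by
  have key : ∀ x y i, T x i ≤ T y i + dist x y := by
    intro x y i
    rw [← hadd]
    refine hmono (fun j => ?_) i
    have h := (le_abs_self _).trans ((Real.dist_eq (x j) (y j)).symm.le.trans (dist_le_pi_dist x y j))
    linarith
  refine LipschitzWith.of_dist_le_mul fun x y => ?_
  rw [NNReal.coe_one, one_mul, dist_pi_le_iff dist_nonneg]
  intro i
  rw [Real.dist_eq, abs_le]
  have h₁ := key x y i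
  have h₂ := key y x i
  rw [dist_comm] at h₂
  constructor <;> linarith

/-- A monotone, additively homogeneous self-map of `ℝ^ι` whose values have bounded oscillation
has an additive eigenvector. -/
theorem exists_additive_eigenvector {ι : Type*} [Fintype ι] [Nonempty ι]
    {T : (ι → ℝ) → ι → ℝ} (hmono : Monotone T)
    (hadd : ∀ (x : ι → ℝ) (c : ℝ) (i : ι), T (fun j => x j + c) i = T x i + c)
    {R : ℝ} (hR : ∀ x i j, |T x i - T x j| ≤ R) :
    ∃ (l : ℝ) (y : ι → ℝ), ∀ i, T y i = l + y i := by
  have hT := lipschitzWith_one_of_monotone_of_add_const hmono hadd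
  obtain ⟨i₀⟩ := ‹Nonempty ι›
  obtain ⟨u, -, hu, hlim⟩ := exists_seq_strictMono_tendsto' (zero_lt_one : (0 : ℝ) < 1)
  -- The discounted maps `x ↦ T (u k • x)` are contractions.
  have hfix : ∀ k, ∃ x : ι → ℝ, T (u k • x) = x := by
    intro k
    have hc : ContractingWith ⟨u k, (hu k).1.le⟩ fun x : ι → ℝ => T (u k • x) := by
      refine ⟨by exact_mod_cast (hu k).2, LipschitzWith.of_dist_le_mul fun x y => ?_⟩
      calc dist (T (u k • x)) (T (u k • y)) ≤ dist (u k • x) (u k • y) := by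
            simpa using hT.dist_le_mul (u k • x) (u k • y)
        _ = u k * dist x y := by rw [dist_smul₀, Real.norm_of_nonneg (hu k).1.le]
    exact ⟨_, hc.fixedPoint_isFixedPt⟩
  choose x hx using hfix
  -- The `x k` may be unbounded as `u k → 1`; only their coordinate differences are controlled.
  let y : ℕ → ι → ℝ := fun k i => x k i - x k i₀
  have hyT : ∀ k i, T (u k • y k) i = x k i - u k * x k i₀ := by
    intro k i
    have h := hadd (u k • x k) (-(u k * x k i₀)) i
    rw [hx, ← sub_eq_add_neg] at h
    rw [← h]
    congr 1
    ext j
    simp only [y, Pi.smul_apply, smul_eq_mul]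
    ring
  have hy : ∀ k, y k ∈ Metric.closedBall (0 : ι → ℝ) R := by
    intro k
    rw [mem_closedBall_zero_iff, pi_norm_le_iff_of_nonneg ((abs_nonneg _).trans (hR 0 i₀ i₀))]
    intro i
    have h := hR (u k • x k) i i₀
    rwa [hx] at h
  obtain ⟨z, -, φ, hφ, hz⟩ := (isCompact_closedBall (0 : ι → ℝ) R).tendsto_subseq hy
  have hTz : Filter.Tendsto (fun k => T (u (φ k) • y (φ k))) Filter.atTop (nhds (T z)) := by
    have h := (hlim.comp hφ.tendsto_atTop).smul hz
    rw [one_smul] at h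
    exact (hT.continuous.tendsto z).comp h
  -- The eigenvalue is the limit of `(1 - u k) * x k i₀`, which is `T (u k • y k) i₀`.
  refine ⟨T z i₀, z, fun i => tendsto_nhds_unique (tendsto_pi_nhds.mp hTz i) ?_⟩
  refine ((tendsto_pi_nhds.mp hTz i₀).add (tendsto_pi_nhds.mp hz i)).congr fun k => ?_
  simp only [Function.comp_apply, hyT, y]
  ring

/-- Any additive eigenvalue of a monotone, additively homogeneous map is at most any other one;
by symmetry there is at most one. -/
theorem additive_eigenvalue_le {ι : Type*} [Finite ι] [Nonempty ι]
    {T : (ι → ℝ) → ι → ℝ} (hmono : Monotone T)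
    (hadd : ∀ (x : ι → ℝ) (c : ℝ) (i : ι), T (fun j => x j + c) i = T x i + c)
    {x y : ι → ℝ} {l r : ℝ} (hx : ∀ i, T x i = l + x i) (hy : ∀ i, T y i = r + y i) :
    l ≤ r := by
  -- Shift `y` up until it dominates `x` and touches it at `i`.
  obtain ⟨i, hi⟩ := Finite.exists_max fun i => x i - y i
  have h : T x i ≤ T (fun j => y j + (x i - y i)) i :=
    hmono (fun j => by linarith [hi j]) i
  rw [hadd, hx, hy] at h
  linarith

/-- The `i`-th tropical form of `A`, as a real-valued minimum. -/
noncomputable def tropicalForm {d n : ℕ} [NeZero n] (A : RealTensor (d + 1) n) (x : Fin n → ℝ)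
    (i : Fin n) : ℝ :=
  Finset.univ.inf' Finset.univ_nonempty
    fun J : Fin d → Fin n => A (Fin.cons i J) + ∑ k, x (J k)

theorem tropicalForm_le {d n : ℕ} [NeZero n] (A : RealTensor (d + 1) n) (x : Fin n → ℝ)
    (i : Fin n) (J : Fin d → Fin n) : tropicalForm A x i ≤ A (Fin.cons i J) + ∑ k, x (J k) :=
  Finset.inf'_le _ (Finset.mem_univ J)

theorem exists_tropicalForm_eq {d n : ℕ} [NeZero n] (A : RealTensor (d + 1) n) (x : Fin n → ℝ)
    (i : Fin n) : ∃ J : Fin d → Fin n, tropicalForm A x i = A (Fin.cons i J) + ∑ k, x (J k) := by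
  obtain ⟨J, -, hJ⟩ := Finset.exists_mem_eq_inf' Finset.univ_nonempty
    fun J : Fin d → Fin n => A (Fin.cons i J) + ∑ k, x (J k)
  exact ⟨J, hJ⟩

theorem tropicalForm_mono {d n : ℕ} [NeZero n] (A : RealTensor (d + 1) n) :
    Monotone (tropicalForm A) := by
  intro x y hxy i
  obtain ⟨J, hJ⟩ := exists_tropicalForm_eq A y i
  rw [hJ]
  exact (tropicalForm_le A x i J).trans
    (add_le_add_right (Finset.sum_le_sum fun k _ => hxy (J k)) _)

theorem tropicalForm_add_const {d n : ℕ} [NeZero n] (A : RealTensor (d + 1) n) (x : Fin n → ℝ)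
    (c : ℝ) (i : Fin n) : tropicalForm A (fun j => x j + c) i = tropicalForm A x i + d * c := by
  have hsum : ∀ J : Fin d → Fin n, ∑ k, (x (J k) + c) = ∑ k, x (J k) + d * c := by
    simp [Finset.sum_add_distrib]
  apply le_antisymm
  · obtain ⟨J, hJ⟩ := exists_tropicalForm_eq A x i
    have h := tropicalForm_le A (fun j => x j + c) i J
    rw [hsum] at h
    linarith
  · obtain ⟨J, hJ⟩ := exists_tropicalForm_eq A (fun j => x j + c) i
    have h := tropicalForm_le A x i J
    rw [hsum] at hJ
    linarith

/-- The term `∑ k, x (J k)` does not involve `i`, so a minimizing `J` for one form, tested in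
another, costs at most `max A - min A`. -/
theorem exists_abs_tropicalForm_sub_le {d n : ℕ} [NeZero n] (A : RealTensor (d + 1) n) :
    ∃ R : ℝ, ∀ x i j, |tropicalForm A x i - tropicalForm A x j| ≤ R := by
  obtain ⟨I, hI⟩ := Finite.exists_max A
  obtain ⟨I', hI'⟩ := Finite.exists_min A
  have key : ∀ x i j, tropicalForm A x i ≤ tropicalForm A x j + (A I - A I') := by
    intro x i j
    obtain ⟨J, hJ⟩ := exists_tropicalForm_eq A x j
    linarith [tropicalForm_le A x i J, hI (Fin.cons i J), hI' (Fin.cons j J)]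
  exact ⟨A I - A I', fun x i j => abs_le.mpr ⟨by linarith [key x j i], by linarith [key x i j]⟩⟩

theorem toTrop_add {r s : ℝ} : toTrop (r + s) = toTrop r * toTrop s := rfl

theorem toTrop_injective : Function.Injective toTrop :=
  fun _ _ h => WithTop.coe_injective (Tropical.trop_injective h)

theorem toTrop_sum {ι : Type*} (s : Finset ι) (f : ι → ℝ) :
    toTrop (∑ k ∈ s, f k) = ∏ k ∈ s, toTrop (f k) := by
  classical
  induction s using Finset.induction_on with
  | empty => rfl
  | insert a s ha ih => rw [Finset.sum_insert ha, Finset.prod_insert ha, toTrop_add, ih]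

theorem toTrop_nat_mul (d : ℕ) (r : ℝ) : toTrop (d * r) = toTrop r ^ d := by
  simpa using toTrop_sum (Finset.univ : Finset (Fin d)) fun _ => r

/-- Nonemptiness matters: the empty tropical sum is `∞`, not a real number. -/
theorem toTrop_inf' {ι : Type*} {s : Finset ι} (hs : s.Nonempty) (f : ι → ℝ) :
    toTrop (s.inf' hs f) = ∑ j ∈ s, toTrop (f j) := by
  rw [← Tropical.untrop_inj_iff, Finset.untrop_sum', ← Finset.inf'_eq_inf hs]
  exact Finset.apply_inf'_eq_inf'_comp hs (fun r : ℝ => (r : WithTop ℝ))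
    fun _ _ => WithTop.coe_min _ _

theorem tropicalHEquations_iff {d n : ℕ} [NeZero n] (A : RealTensor (d + 1) n) (x : Fin n → ℝ)
    (l : ℝ) : TropicalHEquations A x l ↔ ∀ i, tropicalForm A x i = l + d * x i := by
  refine forall_congr' fun i => ?_
  rw [← toTrop_injective.eq_iff, tropicalForm, toTrop_inf', toTrop_add, toTrop_nat_mul]
  simp only [toTrop_add, toTrop_sum]

theorem isTropicalHEigenvalue_iff {d n : ℕ} [NeZero n] (A : RealTensor (d + 1) n) (l : ℝ) :
    IsTropicalHEigenvalue A l ↔ ∃ x : Fin n → ℝ, ∀ i, tropicalForm A x i = l + d * x i := by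
  simp only [← tropicalHEquations_iff]
  constructor
  · rintro ⟨-, x, -, h⟩
    exact ⟨x, h⟩
  · rintro ⟨x, h⟩
    exact ⟨_, x, rfl, h⟩

theorem mainTheorem2 (d n : ℕ) (hd : 1 ≤ d) (hn : 1 ≤ n) (A : RealTensor (d + 1) n) :
    ∃! l : ℝ, IsTropicalHEigenvalue A l := by
  have : NeZero n := ⟨by omega⟩
  have hd₀ : (0 : ℝ) < d := by exact_mod_cast hd
  simp only [isTropicalHEigenvalue_iff]
  let T : (Fin n → ℝ) → Fin n → ℝ := fun x i => tropicalForm A x i / d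
  have hmono : Monotone T := fun x y hxy i =>
    div_le_div_of_nonneg_right (tropicalForm_mono A hxy i) hd₀.le
  have hadd : ∀ (x : Fin n → ℝ) (c : ℝ) (i : Fin n), T (fun j => x j + c) i = T x i + c := by
    intro x c i
    simp only [T, tropicalForm_add_const]
    field_simp
  obtain ⟨R, hR⟩ := exists_abs_tropicalForm_sub_le A
  have hTR : ∀ x i j, |T x i - T x j| ≤ R / d := by
    intro x i j
    rw [← sub_div, abs_div, abs_of_pos hd₀]
    exact div_le_div_of_nonneg_right (hR x i j) hd₀.le
  have hT : ∀ {x : Fin n → ℝ} {l : ℝ}, (∀ i, tropicalForm A x i = l + d * x i) →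
      ∀ i, T x i = l / d + x i := by
    intro x l h i
    simp only [T, h]
    field_simp
  obtain ⟨l, x, hx⟩ := exists_additive_eigenvector hmono hadd hTR
  have hx' : ∀ i, tropicalForm A x i = d * l + d * x i := by
    intro i
    have h := hx i
    simp only [T] at h
    rw [div_eq_iff hd₀.ne'] at h
    linarith
  refine ⟨d * l, ⟨x, hx'⟩, ?_⟩
  rintro r ⟨y, hy⟩
  have h : r / d = d * l / d :=
    le_antisymm (additive_eigenvalue_le hmono hadd (hT hy) (hT hx'))
      (additive_eigenvalue_le hmono hadd (hT hx') (hT hy))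
  exact (div_left_inj' hd₀.ne').mp h
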